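/- **Setting.** Let $J\ge 1$. The MIMIC model with parameter $\Xi=(\beta,(a_j),(d_j),(\gamma_j))_{j=1,\dots,J}$ (real entries) describes individuals $i=1,2,\dots$ with group $x_i\in\{0,1\}$, latent trait $\theta_i$ and binary responses $Y_{i1},\dots,Y_{iJ}$. For every $N$, given $x_1,\dots,x_N$ (fixed or random), the pairs $(\theta_i,Y_i)$, $i\le N$, are independent, $\theta_i\sim N(\beta x_i,1)$, and given $\theta_i$ the $Y_{ij}$ are independent over $j$ with $$P(Y_{ij}=1\mid\theta_i,x_i)=\frac{\exp(a_j\theta_i+d_j+\gamma_jx_i)}{1+\exp(a_j\theta_i+d_j+\gamma_jx_i)} .$$ Let $L_N(\Xi)$ be the marginal likelihood of the first $N$ individuals (the product over $i\le N$ of the probability of $Y_i$ given $x_i$, with $\theta_i$ integrated out). Replacing $(\beta,\gamma_j)$ by $(\beta+c,\gamma_j-a_jc)$, $c\in\mathbb R$, or $(\beta,a_j)$ by $(-\beta,-a_j)$ does not change the law of the responses. **Assumptions.** The data follow the model with the true parameter $\Xi^*=(\beta^*,(a^*_j),(d^*_j),(\gamma^*_j))$, and for every $M$ each of the two groups has at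 least $M$ members among the first $N$ individuals with probability tending to $1$ as $N\to\infty$. The minimal $L_1$ condition $\sum_j|\gamma_j^*|<\sum_j|\gamma_j^*-a_j^*c|$ holds for all $c\ne0$. Let $\Theta$ be a set of parameters (the parameter space; all parameters are allowed), and let $\Xi^\dagger=(\beta^*+c,(a_j^*),(d_j^*),(\gamma_j^*-a_j^*c))\in\Theta$, for some $c\in\mathbb R$, be the equivalent parameter with $\gamma_1^\dagger=0$. It is identified: every $\Xi\in\Theta$ with $\gamma_1=0$ that gives the same response probabilities as $\Xi^\dagger$ in both groups equals $\Xi^\dagger$, or $\Xi^\dagger$ with $\beta^\dagger$ and all $a_j^\dagger$ changed in sign. **Estimator.** $\tilde\Xi_N$ and $\hat c_N$ are functions of the data of the first $N$ individuals such that, with probability tending to $1$ as $N\to\infty$, $\tilde\Xi_N$ maximizes $\log L_N(\Xi)$ over the $\Xi\in\Theta$ with $\gamma_1=0$ and $\hat c_N$ minimizes $c\mapsto\sum_j|\tilde\gamma_j-\tilde a_jc|$. For some compact $K\subseteq\Theta$, $P(\tilde\Xi_N\in K)\to1$. The ML1 estimates of the DIF effects are $\hat\gamma_j=\tilde\gamma_j-\tilde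 a_j\hat c_N$. **Theorem.** Let $\delta>0$ be fixed with $\delta<|\gamma_j^*|$ for every $j$ such that $\gamma_j^*\ne0$. Then for every $j=1,\dots,J$, $$P\bigl(1_{\{|\hat\gamma_j|\le\delta\}}=1_{\{\gamma_j^*=0\}}\bigr)\longrightarrow1\qquad(N\to\infty).$$ -/

import Mathlib

open MeasureTheory ProbabilityTheory Filter Topology

noncomputable section

namespace MIMIC

/-- Parameter vector `Ξ = {β, a_j, d_j, γ_j, j = 1, ..., J}` of the MIMIC model with `J` items. -/
@[ext]
structure Param (J : ℕ) where
  /-- group effect on the latent trait -/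
  β : ℝ
  /-- discrimination parameters -/
  a : Fin J → ℝ
  /-- easiness parameters -/
  d : Fin J → ℝ
  /-- DIF effects -/
  γ : Fin J → ℝ

/-- The Euclidean topology of the parameter space `ℝ × ℝ^J × ℝ^J × ℝ^J`. -/
instance (J : ℕ) : TopologicalSpace (Param J) :=
  TopologicalSpace.induced (fun Ξ => (Ξ.β, Ξ.a, Ξ.d, Ξ.γ)) inferInstance

/-- `β ↦ β + c`, `γ_j ↦ γ_j - a_j c`, with all `a_j`, `d_j` unchanged. -/
def Param.shift {J : ℕ} (Ξ : Param J) (c : ℝ) : Param J where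
  β := Ξ.β + c
  a := Ξ.a
  d := Ξ.d
  γ := fun j => Ξ.γ j - Ξ.a j * c

/-- Change of sign of the latent trait: `β ↦ -β`, `a_j ↦ -a_j`, with all `d_j`, `γ_j` unchanged. -/
def Param.reflect {J : ℕ} (Ξ : Param J) : Param J where
  β := -Ξ.β
  a := fun j => -Ξ.a j
  d := Ξ.d
  γ := Ξ.γ

/-- The 2PL model with DIF: `P(Y_j = y | θ = t, x)` for `y ∈ {0, 1}`. -/
def itemProb {J : ℕ} (Ξ : Param J) (j : Fin J) (t : ℝ) (x y : Fin 2) : ℝ :=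
  Real.exp ((y : ℕ) * (Ξ.a j * t + Ξ.d j + Ξ.γ j * (x : ℕ))) /
    (1 + Real.exp (Ξ.a j * t + Ξ.d j + Ξ.γ j * (x : ℕ)))

/-- The law `N(β x, 1)` of the latent trait in group `x`. -/
def traitLaw {J : ℕ} (Ξ : Param J) (x : Fin 2) : Measure ℝ :=
  gaussianReal (Ξ.β * (x : ℕ)) 1

/-- Marginal probability of the response vector `y` in group `x`. -/
def marginalProb {J : ℕ} (Ξ : Param J) (x : Fin 2) (y : Fin J → Fin 2) : ℝ :=
  ∫ t, ∏ j, itemProb Ξ j t x (y j) ∂(traitLaw Ξ x)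

/-- The observed data of `N` individuals: group memberships and response vectors. -/
abbrev Data (J N : ℕ) : Type := Fin N → Fin 2 × (Fin J → Fin 2)

/-- The marginal likelihood `L(Ξ)`. -/
def likelihood {J N : ℕ} (D : Data J N) (Ξ : Param J) : ℝ :=
  ∏ i, marginalProb Ξ (D i).1 (D i).2

/-- `Ξt` solves `max log L(Ξ)` subject to `γ_1 = 0`, over the parameter space `Θ`
(item 1 has the index `0 : Fin J`). -/
def IsMMLEstimate {J N : ℕ} [NeZero J] (Θ : Set (Param J)) (D : Data J N) (Ξt : Param J) : Prop :=
  (Ξt ∈ Θ ∧ Ξt.γ 0 = 0) ∧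
    ∀ Ξ ∈ Θ, Ξ.γ 0 = 0 → Real.log (likelihood D Ξ) ≤ Real.log (likelihood D Ξt)

/-- `c` minimizes `∑ j, |γ_j - a_j c|`. -/
def IsLADMinimizer {J : ℕ} (Ξ : Param J) (c : ℝ) : Prop :=
  ∀ c' : ℝ, ∑ j, |Ξ.γ j - Ξ.a j * c| ≤ ∑ j, |Ξ.γ j - Ξ.a j * c'|

/-- The minimal `L₁` condition. -/
def ML1Condition {J : ℕ} (Ξ : Param J) : Prop :=
  ∀ c : ℝ, c ≠ 0 → ∑ j, |Ξ.γ j| < ∑ j, |Ξ.γ j - Ξ.a j * c|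

/-- The individuals `0, 1, 2, ...`, with groups `x i`, latent traits `θ i` and response vectors
`Y i`, follow the MIMIC model with parameter `Ξ`: given the groups of any first `N` individuals,
the pairs `(θ i, Y i)` are independent over `i < N`, the trait `θ i` has the law `N(β x i, 1)`,
and given `θ i` the responses `Y i j` are independent over `j` and follow the 2PL model with DIF.
The groups may be fixed or random, with any joint law. -/
structure IsModel {Ω : Type*} [MeasurableSpace Ω] {J : ℕ} (μ : Measure Ω) (Ξ : Param J)
    (x : ℕ → Ω → Fin 2) (θ : ℕ → Ω → ℝ) (Y : ℕ → Ω → Fin J → Fin 2) : Prop where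
  measurable_x : ∀ i, Measurable (x i)
  measurable_θ : ∀ i, Measurable (θ i)
  measurable_Y : ∀ i, Measurable (Y i)
  law : ∀ (N : ℕ) (u : Fin N → Fin 2) (B : Fin N → Set ℝ) (y : Fin N → Fin J → Fin 2),
    (∀ i, MeasurableSet (B i)) →
      μ.real {ω | ∀ i : Fin N, x i ω = u i ∧ θ i ω ∈ B i ∧ Y i ω = y i} =
        μ.real {ω | ∀ i : Fin N, x i ω = u i} *
          ∏ i, ∫ t in B i, ∏ j, itemProb Ξ j t (u i) (y i j) ∂(traitLaw Ξ (u i))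

/-- The data of the first `N` individuals. -/
def sample {Ω : Type*} {J : ℕ} (x : ℕ → Ω → Fin 2) (Y : ℕ → Ω → Fin J → Fin 2) (N : ℕ) (ω : Ω) :
    Data J N :=
  fun i => (x i ω, Y i ω)

end MIMIC

end

noncomputable section

namespace MIMIC

/-! ### Marginal probabilities -/

section Marginal

variable {J : ℕ}

/-! With finitely many items the data reduce to counts in the `2 * 2 ^ J` cells (group, response
vector), so consistency needs no uniform law of large numbers. Let `Ξ` be at least as likely as the
true law. Then the squared Hellinger distance from the observed counts to their fit under `Ξ` is at
most their relative entropy to that fit, hence at most their relative entropy to the true law, hence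
at most Pearson's chi-square at the truth. This gives `groupCount_mul_sq_sub_le`. The mean of that
chi-square is at most `2 * 2 ^ J` for every `N` and every law of the groups
(`IsModel.integral_chiSq_le`). As the groups grow, the fitted cell probabilities therefore converge
in probability to the true ones.

On the compact `K`, identification turns this into closeness of the estimate to `Ξdag` or its
reflection (`exists_pos_forall_mem_of_marginalDist_lt`, `IsModel.tendsto_measure_estimate_mem`).

The L₁ step is stable there: its objective is convex in `c`, and the minimal L₁ condition puts a
strict minimum of the limiting objective at the shift that undoes `c₀`. Comparing three values of
`c` confines every minimizer for a nearby parameter (`ML1Condition.eventually_abs_shift_sub_lt`). A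
reflection changes the signs of `a` and `c` together, so `γ - a c` is unaffected. The estimated
effects are thus close to the true ones, and the threshold separates zero from nonzero effects. -/

lemma itemProb_pos (Ξ : Param J) (j : Fin J) (t : ℝ) (x y : Fin 2) : 0 < itemProb Ξ j t x y := by
  unfold itemProb
  positivity

lemma sum_itemProb (Ξ : Param J) (j : Fin J) (t : ℝ) (x : Fin 2) :
    ∑ y, itemProb Ξ j t x y = 1 := by
  have h := Real.exp_pos (Ξ.a j * t + Ξ.d j + Ξ.γ j * (x : ℕ))
  simp only [Fin.sum_univ_two, itemProb, Fin.val_zero, Fin.val_one, Nat.cast_zero, Nat.cast_one,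
    zero_mul, one_mul, Real.exp_zero]
  rw [← add_div, div_self (by positivity)]

lemma itemProb_le_one (Ξ : Param J) (j : Fin J) (t : ℝ) (x y : Fin 2) : itemProb Ξ j t x y ≤ 1 := by
  rw [← sum_itemProb Ξ j t x]
  exact Finset.single_le_sum (fun z _ => (itemProb_pos Ξ j t x z).le) (Finset.mem_univ y)

lemma continuous_coords : Continuous (fun Ξ : Param J => (Ξ.β, Ξ.a, Ξ.d, Ξ.γ)) :=
  continuous_induced_dom

instance : FirstCountableTopology (Param J) :=
  Topology.IsInducing.firstCountableTopology (f := fun Ξ : Param J => (Ξ.β, Ξ.a, Ξ.d, Ξ.γ)) ⟨rfl⟩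

lemma continuous_β : Continuous (fun Ξ : Param J => Ξ.β) :=
  continuous_coords.fst

lemma continuous_a (j : Fin J) : Continuous (fun Ξ : Param J => Ξ.a j) :=
  (continuous_apply j).comp continuous_coords.snd.fst

lemma continuous_d (j : Fin J) : Continuous (fun Ξ : Param J => Ξ.d j) :=
  (continuous_apply j).comp continuous_coords.snd.snd.fst

lemma continuous_γ (j : Fin J) : Continuous (fun Ξ : Param J => Ξ.γ j) :=
  (continuous_apply j).comp continuous_coords.snd.snd.snd

lemma continuous_itemProb (j : Fin J) (x y : Fin 2) :
    Continuous (fun q : Param J × ℝ => itemProb q.1 j q.2 x y) := by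
  have ha := (continuous_a j).comp (continuous_fst (X := Param J) (Y := ℝ))
  have hd := (continuous_d j).comp (continuous_fst (X := Param J) (Y := ℝ))
  have hγ := (continuous_γ j).comp (continuous_fst (X := Param J) (Y := ℝ))
  have h : Continuous (fun q : Param J × ℝ => q.1.a j * q.2 + q.1.d j + q.1.γ j * (x : ℕ)) :=
    ((ha.mul continuous_snd).add hd).add (hγ.mul continuous_const)
  unfold itemProb
  exact (Real.continuous_exp.comp (continuous_const.mul h)).div
    (continuous_const.add (Real.continuous_exp.comp h)) (fun q => by positivity)

lemma continuous_prod_itemProb (x : Fin 2) (y : Fin J → Fin 2) :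
    Continuous (fun q : Param J × ℝ => ∏ j, itemProb q.1 j q.2 x (y j)) :=
  continuous_finsetProd _ fun j _ => continuous_itemProb j x (y j)

lemma prod_itemProb_pos (Ξ : Param J) (t : ℝ) (x : Fin 2) (y : Fin J → Fin 2) :
    0 < ∏ j, itemProb Ξ j t x (y j) :=
  Finset.prod_pos fun j _ => itemProb_pos Ξ j t x (y j)

lemma prod_itemProb_le_one (Ξ : Param J) (t : ℝ) (x : Fin 2) (y : Fin J → Fin 2) :
    ∏ j, itemProb Ξ j t x (y j) ≤ 1 :=
  Finset.prod_le_one (fun j _ => (itemProb_pos Ξ j t x (y j)).le)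
    fun j _ => itemProb_le_one Ξ j t x (y j)

lemma norm_prod_itemProb_le_one (Ξ : Param J) (t : ℝ) (x : Fin 2) (y : Fin J → Fin 2) :
    ‖∏ j, itemProb Ξ j t x (y j)‖ ≤ 1 := by
  rw [Real.norm_of_nonneg (prod_itemProb_pos Ξ t x y).le]
  exact prod_itemProb_le_one Ξ t x y

lemma continuous_prod_itemProb_right (Ξ : Param J) (x : Fin 2) (y : Fin J → Fin 2) :
    Continuous (fun t => ∏ j, itemProb Ξ j t x (y j)) :=
  (continuous_prod_itemProb x y).comp (by fun_prop : Continuous fun t : ℝ => (Ξ, t))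

instance (Ξ : Param J) (x : Fin 2) : IsProbabilityMeasure (traitLaw Ξ x) := by
  unfold traitLaw; infer_instance

lemma integrable_prod_itemProb (Ξ Ξ' : Param J) (x : Fin 2) (y : Fin J → Fin 2) :
    Integrable (fun t => ∏ j, itemProb Ξ j t x (y j)) (traitLaw Ξ' x) :=
  Integrable.of_bound (continuous_prod_itemProb_right Ξ x y).aestronglyMeasurable 1
    (Eventually.of_forall fun t => norm_prod_itemProb_le_one Ξ t x y)

lemma marginalProb_pos (Ξ : Param J) (x : Fin 2) (y : Fin J → Fin 2) : 0 < marginalProb Ξ x y := by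
  unfold marginalProb
  rw [integral_pos_iff_support_of_nonneg (fun t => (prod_itemProb_pos Ξ t x y).le)
    (integrable_prod_itemProb Ξ Ξ x y)]
  have : Function.support (fun t => ∏ j, itemProb Ξ j t x (y j)) = Set.univ := by
    ext t
    simpa using (prod_itemProb_pos Ξ t x y).ne'
  rw [this]
  simp

lemma sum_marginalProb (Ξ : Param J) (x : Fin 2) : ∑ y, marginalProb Ξ x y = 1 := by
  unfold marginalProb
  rw [← integral_finsetSum _ fun y _ => integrable_prod_itemProb Ξ Ξ x y]
  have h : ∀ t, ∑ y : Fin J → Fin 2, ∏ j, itemProb Ξ j t x (y j) = 1 := fun t => by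
    have := Finset.prod_univ_sum (fun _ : Fin J => (Finset.univ : Finset (Fin 2)))
      (fun j z => itemProb Ξ j t x z)
    simp only [sum_itemProb, Finset.prod_const_one, Fintype.piFinset_univ] at this
    exact this.symm
  simp [h]

lemma marginalProb_le_one (Ξ : Param J) (x : Fin 2) (y : Fin J → Fin 2) :
    marginalProb Ξ x y ≤ 1 := by
  rw [← sum_marginalProb Ξ x]
  exact Finset.single_le_sum (fun z _ => (marginalProb_pos Ξ x z).le) (Finset.mem_univ y)

/-- The marginal probability as an integral over a standard normal variable. -/
lemma marginalProb_eq_standard (Ξ : Param J) (x : Fin 2) (y : Fin J → Fin 2) :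
    marginalProb Ξ x y =
      ∫ t, ∏ j, itemProb Ξ j (t + Ξ.β * (x : ℕ)) x (y j) ∂(gaussianReal 0 1) := by
  have h : traitLaw Ξ x = (gaussianReal 0 1).map (· + Ξ.β * ((x : ℕ) : ℝ)) := by
    rw [gaussianReal_map_add_const, zero_add]; rfl
  unfold marginalProb
  rw [h, integral_map (by fun_prop) (continuous_prod_itemProb_right Ξ x y).aestronglyMeasurable]

/-- Standardizing the trait moves `β` from the measure into the integrand, so dominated convergence
applies with the constant bound 1. -/
lemma continuous_marginalProb (x : Fin 2) (y : Fin J → Fin 2) :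
    Continuous (fun Ξ : Param J => marginalProb Ξ x y) := by
  simp only [marginalProb_eq_standard]
  have hcont : Continuous (fun q : Param J × ℝ =>
      ∏ j, itemProb q.1 j (q.2 + q.1.β * ((x : ℕ) : ℝ)) x (y j)) :=
    (continuous_prod_itemProb x y).comp (continuous_fst.prodMk
      (continuous_snd.add ((continuous_β.comp continuous_fst).mul continuous_const)))
  refine continuous_of_dominated (F := fun (Ξ : Param J) t =>
      ∏ j, itemProb Ξ j (t + Ξ.β * ((x : ℕ) : ℝ)) x (y j)) (bound := fun _ => 1)
    (fun Ξ => ?_) (fun Ξ => ?_) (integrable_const _) ?_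
  · exact (hcont.comp (by fun_prop : Continuous fun t : ℝ => (Ξ, t))).aestronglyMeasurable
  · exact Eventually.of_forall fun t => norm_prod_itemProb_le_one Ξ _ x y
  · exact Eventually.of_forall fun t => hcont.comp (continuous_id.prodMk continuous_const)

/-- After standardization `c` cancels in the linear predictor, pointwise in `t`. -/
lemma marginalProb_shift (Ξ : Param J) (c : ℝ) (x : Fin 2) (y : Fin J → Fin 2) :
    marginalProb (Ξ.shift c) x y = marginalProb Ξ x y := by
  simp only [marginalProb_eq_standard]
  have h : ∀ j t z, itemProb (Ξ.shift c) j (t + (Ξ.shift c).β * (x : ℕ)) x z =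
      itemProb Ξ j (t + Ξ.β * (x : ℕ)) x z := fun j t z => by
    simp only [itemProb, Param.shift]
    have : Ξ.a j * (t + (Ξ.β + c) * (x : ℕ)) + Ξ.d j + (Ξ.γ j - Ξ.a j * c) * (x : ℕ) =
        Ξ.a j * (t + Ξ.β * (x : ℕ)) + Ξ.d j + Ξ.γ j * (x : ℕ) := by ring
    rw [this]
  simp only [h]

end Marginal

/-! ### The chi-square statistic -/

section ChiSq

variable {J N : ℕ}

/-- The number of individuals of group `g`. -/
def groupCount (D : Data J N) (g : Fin 2) : ℕ :=
  (Finset.univ.filter fun i => (D i).1 = g).card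

/-- The number of individuals of group `g` with response vector `z`. -/
def cellCount (D : Data J N) (g : Fin 2) (z : Fin J → Fin 2) : ℕ :=
  (Finset.univ.filter fun i => D i = (g, z)).card

/-- Pearson's chi-square statistic of the response vectors in both groups. -/
def chiSq (Ξ : Param J) (D : Data J N) : ℝ :=
  ∑ g, ∑ z, (cellCount D g z - groupCount D g * marginalProb Ξ g z) ^ 2 /
    (groupCount D g * marginalProb Ξ g z)

lemma chiSq_nonneg (Ξ : Param J) (D : Data J N) : 0 ≤ chiSq Ξ D :=
  Finset.sum_nonneg fun g _ => Finset.sum_nonneg fun z _ => by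
    have := (marginalProb_pos Ξ g z).le
    positivity

lemma sum_cellCount (D : Data J N) (g : Fin 2) : ∑ z, cellCount D g z = groupCount D g := by
  unfold groupCount cellCount
  rw [Finset.card_eq_sum_card_fiberwise (f := fun i => (D i).2) (t := Finset.univ)
    (fun _ _ => Finset.mem_coe.2 (Finset.mem_univ _))]
  refine Finset.sum_congr rfl fun z _ => ?_
  rw [Finset.filter_filter]
  simp only [Prod.ext_iff]

lemma sum_cellCount_cast (D : Data J N) (g : Fin 2) :
    ∑ z, (cellCount D g z : ℝ) = groupCount D g := by
  exact_mod_cast sum_cellCount D g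

lemma cellCount_le (D : Data J N) (g : Fin 2) (z : Fin J → Fin 2) :
    cellCount D g z ≤ groupCount D g := by
  rw [← sum_cellCount]
  exact Finset.single_le_sum (fun _ _ => Nat.zero_le _) (Finset.mem_univ z)

lemma log_likelihood (D : Data J N) (Ξ : Param J) :
    Real.log (likelihood D Ξ) = ∑ g, ∑ z, cellCount D g z * Real.log (marginalProb Ξ g z) := by
  unfold likelihood
  rw [Real.log_prod fun i _ => (marginalProb_pos Ξ _ _).ne', ← Fintype.sum_prod_type'
    (f := fun g z => cellCount D g z * Real.log (marginalProb Ξ g z)),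
    ← Finset.sum_fiberwise (s := Finset.univ) (g := D)]
  refine Finset.sum_congr rfl fun q _ => ?_
  rw [Finset.sum_congr rfl (g := fun _ => Real.log (marginalProb Ξ q.1 q.2)) fun i hi => by
    rw [(Finset.mem_filter.1 hi).2]]
  simp [cellCount]

/-- Hellinger distance is bounded by relative entropy, cell by cell. -/
lemma sq_sqrt_sub_sqrt_le {n N q : ℝ} (hn : 0 ≤ n) (hnN : n ≤ N) (hq : 0 < q) :
    (√n - √(N * q)) ^ 2 + (n - N * q) ≤ n * (Real.log (n / N) - Real.log q) := by
  have hNq : 0 ≤ N * q := mul_nonneg (hn.trans hnN) hq.le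
  rcases hn.eq_or_lt with rfl | hn
  · simp [Real.sq_sqrt hNq]
  have hN := hn.trans_le hnN
  have h1 : 0 < √n := Real.sqrt_pos.2 hn
  have h2 : 0 < √(N * q) := Real.sqrt_pos.2 (mul_pos hN hq)
  -- `log s ≤ s - 1` at `s = √(N q) / √n`; the left side of the goal is exactly `2 n (1 - s)`, and
  -- its right side is `-2 n log s`.
  have h3 := Real.log_le_sub_one_of_pos (div_pos h2 h1)
  rw [Real.log_div h2.ne' h1.ne', Real.log_sqrt hNq, Real.log_sqrt hn.le,
    Real.log_mul hN.ne' hq.ne'] at h3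
  rw [Real.log_div hn.ne' hN.ne']
  have h4 : n * (√(N * q) / √n) = √n * √(N * q) := by
    field_simp
    rw [Real.sq_sqrt hn.le]
  have h5 := Real.sq_sqrt hn.le
  have h6 := Real.sq_sqrt hNq
  nlinarith [mul_le_mul_of_nonneg_left h3 hn.le]

/-- Relative entropy is bounded by the chi-square distance, cell by cell. -/
lemma mul_log_sub_log_le {n N p : ℝ} (hn : 0 ≤ n) (hnN : n ≤ N) (hp : 0 < p) :
    n * (Real.log (n / N) - Real.log p) ≤ (n - N * p) ^ 2 / (N * p) + (n - N * p) := by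
  rcases hn.eq_or_lt with rfl | hn
  · rcases hnN.eq_or_lt with rfl | hN
    · simp
    · rw [zero_mul, zero_sub, neg_sq, pow_two, mul_div_assoc, div_self (mul_pos hN hp).ne']
      linarith
  have hN := hn.trans_le hnN
  have h := Real.log_le_sub_one_of_pos (div_pos (div_pos hn hN) hp)
  rw [Real.log_div (div_pos hn hN).ne' hp.ne'] at h
  have h2 := mul_le_mul_of_nonneg_left h hn.le
  have h3 : n * (n / N / p - 1) = (n - N * p) ^ 2 / (N * p) + (n - N * p) := by
    field_simp
    ring
  linarith

/-- If `Ξ` has at least the likelihood of `Ξ'`, then its marginal probabilities differ from those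
of `Ξ'` by a multiple of the chi-square statistic of `Ξ'`. -/
lemma groupCount_mul_sq_sub_le (D : Data J N) (Ξ Ξ' : Param J)
    (h : Real.log (likelihood D Ξ') ≤ Real.log (likelihood D Ξ)) (g : Fin 2) (z : Fin J → Fin 2) :
    groupCount D g * (marginalProb Ξ g z - marginalProb Ξ' g z) ^ 2 ≤ 9 * chiSq Ξ' D := by
  have hcount : ∀ (Ξ : Param J) (g : Fin 2),
      ∑ z, ((cellCount D g z : ℝ) - groupCount D g * marginalProb Ξ g z) = 0 := fun Ξ g => by
    rw [Finset.sum_sub_distrib, sum_cellCount_cast, ← Finset.mul_sum, sum_marginalProb]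
    ring
  have hle : ∀ g z, (cellCount D g z : ℝ) ≤ groupCount D g := fun g z => by
    exact_mod_cast cellCount_le D g z
  -- The linear corrections in both cellwise bounds cancel on summation over `z`, by `hcount`; the
  -- entropy terms `n log (n / N)` are common, so `h` links the two bounds.
  have hell : ∑ g, ∑ z, (√(cellCount D g z) - √(groupCount D g * marginalProb Ξ g z)) ^ 2 ≤
      chiSq Ξ' D := by
    have h1 := Finset.sum_le_sum fun g (_ : g ∈ Finset.univ) =>
      Finset.sum_le_sum fun z (_ : z ∈ Finset.univ) =>
        sq_sqrt_sub_sqrt_le (Nat.cast_nonneg (cellCount D g z)) (hle g z) (marginalProb_pos Ξ g z)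
    have h2 := Finset.sum_le_sum fun g (_ : g ∈ Finset.univ) =>
      Finset.sum_le_sum fun z (_ : z ∈ Finset.univ) =>
        mul_log_sub_log_le (Nat.cast_nonneg (cellCount D g z)) (hle g z) (marginalProb_pos Ξ' g z)
    simp only [log_likelihood] at h
    simp only [Finset.sum_add_distrib, hcount, mul_sub, Finset.sum_sub_distrib] at h1 h2 ⊢
    simp only [Finset.sum_const_zero, add_zero] at h1 h2
    unfold chiSq
    linarith
  set n : ℝ := (cellCount D g z : ℝ)
  set m : ℝ := (groupCount D g : ℝ)
  have hn0 : 0 ≤ n := Nat.cast_nonneg _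
  have hnm : n ≤ m := hle g z
  have hW := chiSq_nonneg Ξ' D
  set W := chiSq Ξ' D
  set q := marginalProb Ξ g z
  set p := marginalProb Ξ' g z
  have hp : 0 < p := marginalProb_pos Ξ' g z
  have hq : 0 < q := marginalProb_pos Ξ g z
  have hp1 : p ≤ 1 := marginalProb_le_one Ξ' g z
  have hq1 : q ≤ 1 := marginalProb_le_one Ξ g z
  have h1 : (√n - √(m * q)) ^ 2 ≤ W :=
    ((Finset.single_le_sum (f := fun z => (√(cellCount D g z : ℝ) -
        √(groupCount D g * marginalProb Ξ g z)) ^ 2)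
        (fun z _ => sq_nonneg _) (Finset.mem_univ z)).trans
      (Finset.single_le_sum (f := fun g => ∑ z, (√(cellCount D g z : ℝ) -
        √(groupCount D g * marginalProb Ξ g z)) ^ 2)
        (fun g _ => Finset.sum_nonneg fun z _ => sq_nonneg _) (Finset.mem_univ g))).trans hell
  have h2 : (n - m * p) ^ 2 / (m * p) ≤ W := by
    have hnn : ∀ g z, 0 ≤ ((cellCount D g z : ℝ) - groupCount D g * marginalProb Ξ' g z) ^ 2 /
        (groupCount D g * marginalProb Ξ' g z) := fun g z => by
      have := (marginalProb_pos Ξ' g z).le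
      positivity
    exact (Finset.single_le_sum (fun z _ => hnn g z) (Finset.mem_univ z)).trans
      (Finset.single_le_sum (f := fun g => ∑ z, ((cellCount D g z : ℝ) -
        groupCount D g * marginalProb Ξ' g z) ^ 2 / (groupCount D g * marginalProb Ξ' g z))
        (fun g _ => Finset.sum_nonneg fun z _ => hnn g z) (Finset.mem_univ g))
  rcases (hn0.trans hnm).eq_or_lt with h0 | hmpos
  · rw [← h0]; simpa using hW
  have h3 : (n - m * p) ^ 2 ≤ m * W := by
    rw [div_le_iff₀ (mul_pos hmpos hp)] at h2
    nlinarith [mul_le_mul_of_nonneg_left hp1 (mul_nonneg hW hmpos.le)]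
  -- Difference of squares: the second factor satisfies `(√n + √(m q))² ≤ 2 (n + m q) ≤ 4 m`.
  have h4 : (n - m * q) ^ 2 ≤ 4 * (m * W) := by
    have hmq : 0 ≤ m * q := by positivity
    have e : n - m * q = (√n - √(m * q)) * (√n + √(m * q)) := by
      nlinarith [Real.sq_sqrt hn0, Real.sq_sqrt hmq]
    have hs : (√n + √(m * q)) ^ 2 ≤ 4 * m := by
      nlinarith [Real.sq_sqrt hn0, Real.sq_sqrt hmq, sq_nonneg (√n - √(m * q))]
    rw [e, mul_pow]
    calc _ ≤ W * (4 * m) := mul_le_mul h1 hs (sq_nonneg _) hW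
      _ = _ := by ring
  -- Triangle inequality: `9 = (1 + 2)²`, from the bounds `h3` and `h4`.
  have h5 : (m * (q - p)) ^ 2 ≤ 9 * (m * W) := by
    have e : m * (q - p) = (n - m * p) - (n - m * q) := by ring
    rw [e]
    nlinarith [sq_nonneg (2 * (n - m * p) + (n - m * q))]
  have h6 : m * (m * (q - p) ^ 2) ≤ m * (9 * W) := by nlinarith
  exact le_of_mul_le_mul_left h6 hmpos

end ChiSq

/-! ### The mean of the chi-square statistic -/

section Mean

/-- The variance of a sum of independent centred variables. -/
lemma sum_prod_mul_sq_sum {ι α : Type*} [Fintype ι] [DecidableEq ι] [Fintype α]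
    (p f : ι → α → ℝ) (hp : ∀ i, ∑ y, p i y = 1) (hf : ∀ i, ∑ y, p i y * f i y = 0) :
    ∑ y : ι → α, (∏ i, p i (y i)) * (∑ i, f i (y i)) ^ 2 = ∑ i, ∑ y, p i y * f i y ^ 2 := by
  have key : ∀ i k, ∑ y : ι → α, (∏ l, p l (y l)) * (f i (y i) * f k (y k)) =
      if k = i then ∑ y, p i y * f i y ^ 2 else 0 := fun i k => by
    -- The indicators place `f i` and `f k` inside the product, so the sum over `y` factorizes over
    -- coordinates. For `i ≠ k` the factor at `i` is a mean, which is zero.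
    have e : ∀ y : ι → α, (∏ l, p l (y l)) * (f i (y i) * f k (y k)) =
        ∏ l, p l (y l) * ((if l = i then f l (y l) else 1) * (if l = k then f l (y l) else 1)) :=
      fun y => by
        simp only [Finset.prod_mul_distrib]
        rw [Finset.prod_ite_eq' _ i (fun l => f l (y l)),
          Finset.prod_ite_eq' _ k (fun l => f l (y l))]
        simp
    have e2 := Finset.prod_univ_sum (fun _ : ι => (Finset.univ : Finset α)) (fun l z =>
      p l z * ((if l = i then f l z else 1) * (if l = k then f l z else 1)))
    rw [Fintype.piFinset_univ] at e2
    simp only [e]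
    rw [← e2]
    split_ifs with hik
    · subst hik
      rw [Finset.prod_eq_single k]
      · exact Finset.sum_congr rfl fun z _ => by simp [pow_two]
      · intro l _ hl
        simp [hl, hp]
      · simp
    · refine Finset.prod_eq_zero (Finset.mem_univ i) ?_
      simpa [Ne.symm hik, eq_comm] using hf i
  have hsq : ∀ y : ι → α, (∑ i, f i (y i)) ^ 2 = ∑ i, ∑ k, f i (y i) * f k (y k) := fun y => by
    rw [pow_two, Finset.sum_mul_sum]
  simp only [hsq, Finset.mul_sum]
  rw [Finset.sum_comm]
  refine Finset.sum_congr rfl fun i _ => ?_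
  rw [Finset.sum_comm]
  simp [key]

variable {J N : ℕ}

/-- Provides the sum of centred terms, one per individual, that `sum_prod_mul_sq_sum` takes; the
other group contributes zeros. -/
lemma cellCount_sub_eq_sum (Ξ : Param J) (u : Fin N → Fin 2) (y : Fin N → Fin J → Fin 2)
    (g : Fin 2) (z : Fin J → Fin 2) :
    (cellCount (fun i => (u i, y i)) g z : ℝ) -
        groupCount (fun i => (u i, y i)) g * marginalProb Ξ g z =
      ∑ i, if u i = g then (if y i = z then 1 else 0) - marginalProb Ξ g z else 0 := by
  have h : ∀ i, (if u i = g then (if y i = z then (1 : ℝ) else 0) - marginalProb Ξ g z else 0) =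
      (if (u i, y i) = (g, z) then 1 else 0) - (if u i = g then 1 else 0) * marginalProb Ξ g z :=
    fun i => by
      by_cases h1 : u i = g <;> simp [h1]
  simp only [h]
  rw [Finset.sum_sub_distrib, ← Finset.sum_mul]
  simp [cellCount, groupCount]

/-- Given the groups, each term of the chi-square statistic has mean at most one. -/
lemma mean_chiSq_cell_le (Ξ : Param J) (u : Fin N → Fin 2) (g : Fin 2) (z : Fin J → Fin 2) :
    ∑ y : Fin N → Fin J → Fin 2, (∏ i, marginalProb Ξ (u i) (y i)) *
      (((cellCount (fun i => (u i, y i)) g z : ℝ) -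
        groupCount (fun i => (u i, y i)) g * marginalProb Ξ g z) ^ 2 /
          (groupCount (fun i => (u i, y i)) g * marginalProb Ξ g z)) ≤ 1 := by
  simp only [cellCount_sub_eq_sum]
  set p := marginalProb Ξ g z with hp
  have hp0 : 0 < p := marginalProb_pos Ξ g z
  have hm : ∀ y : Fin N → Fin J → Fin 2, (groupCount (fun i => (u i, y i)) g : ℝ) =
      ∑ i, if u i = g then 1 else 0 := fun y => by simp [groupCount]
  simp only [hm, ← mul_div_assoc]
  rw [← Finset.sum_div]
  have hvar := sum_prod_mul_sq_sum (fun i y => marginalProb Ξ (u i) y)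
    (fun i y => if u i = g then (if y = z then (1 : ℝ) else 0) - p else 0)
    (fun i => sum_marginalProb Ξ (u i)) (fun i => by
      by_cases h : u i = g
      · simp only [h, if_true, mul_sub, mul_ite, mul_one, mul_zero, Finset.sum_sub_distrib,
          Finset.sum_ite_eq', Finset.mem_univ, ← Finset.sum_mul, sum_marginalProb]
        rw [hp]; ring
      · simp [h])
  rw [hvar]
  -- The binomial variance `m p (1 - p)` is at most the denominator `m p`. An empty group is covered
  -- too, its quotient being `0` by convention.
  refine div_le_one_of_le₀ ?_ (mul_nonneg (Finset.sum_nonneg fun i _ => by positivity) hp0.le)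
  rw [Finset.sum_mul]
  refine Finset.sum_le_sum fun i _ => ?_
  by_cases h : u i = g
  · have e : ∀ y : Fin J → Fin 2, marginalProb Ξ g y * ((if y = z then (1 : ℝ) else 0) - p) ^ 2 =
        (if y = z then marginalProb Ξ g y * (1 - 2 * p) else 0) + marginalProb Ξ g y * p ^ 2 :=
      fun y => by split_ifs <;> ring
    simp only [h, if_true, e, Finset.sum_add_distrib, Finset.sum_ite_eq', Finset.mem_univ,
      ← Finset.sum_mul, sum_marginalProb]
    nlinarith
  · simp [h]

lemma mean_chiSq_le (Ξ : Param J) (u : Fin N → Fin 2) :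
    ∑ y : Fin N → Fin J → Fin 2, (∏ i, marginalProb Ξ (u i) (y i)) *
      chiSq Ξ (fun i => (u i, y i)) ≤ 2 * 2 ^ J := by
  unfold chiSq
  simp only [Finset.mul_sum]
  rw [Finset.sum_comm]
  calc _ ≤ ∑ _g : Fin 2, ∑ _z : Fin J → Fin 2, (1 : ℝ) := by
        refine Finset.sum_le_sum fun g _ => ?_
        rw [Finset.sum_comm]
        exact Finset.sum_le_sum fun z _ => mean_chiSq_cell_le Ξ u g z
    _ = 2 * 2 ^ J := by simp

variable {Ω : Type*} [MeasurableSpace Ω] {μ : Measure Ω}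
  {Ξ : Param J} {x : ℕ → Ω → Fin 2} {θ : ℕ → Ω → ℝ} {Y : ℕ → Ω → Fin J → Fin 2}

lemma IsModel.measurable_sample (h : IsModel μ Ξ x θ Y) (N : ℕ) :
    Measurable (sample x Y N) :=
  measurable_pi_lambda _ fun i => (h.measurable_x i).prodMk (h.measurable_Y i)

/-- The data space is finite, so estimators that are functions of the data need no measurability
assumption. -/
lemma IsModel.measurableSet_sample (h : IsModel μ Ξ x θ Y) (N : ℕ) (P : Data J N → Prop) :
    MeasurableSet {ω | P (sample x Y N ω)} :=
  h.measurable_sample N (Set.toFinite {D | P D}).measurableSet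

/-- The law of the data of the first `N` individuals. -/
lemma IsModel.measureReal_sample (h : IsModel μ Ξ x θ Y) (N : ℕ) (u : Fin N → Fin 2)
    (y : Fin N → Fin J → Fin 2) :
    μ.real (sample x Y N ⁻¹' {fun i => (u i, y i)}) =
      μ.real {ω | ∀ i : Fin N, x i ω = u i} * ∏ i, marginalProb Ξ (u i) (y i) := by
  have := h.law N u (fun _ => Set.univ) y (fun _ => MeasurableSet.univ)
  simp only [Set.mem_univ, true_and, setIntegral_univ] at this
  rw [show (∏ i, marginalProb Ξ (u i) (y i)) =
    ∏ i, ∫ t, ∏ j, itemProb Ξ j t (u i) (y i j) ∂(traitLaw Ξ (u i)) from rfl, ← this]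
  congr 1
  ext ω
  simp [sample, funext_iff, Prod.ext_iff]

/-- The bound given the groups does not depend on them, so it survives averaging over any joint law
of the groups. -/
lemma IsModel.integral_chiSq_le [IsProbabilityMeasure μ] (h : IsModel μ Ξ x θ Y) (N : ℕ) :
    ∫ ω, chiSq Ξ (sample x Y N ω) ∂μ ≤ 2 * 2 ^ J := by
  have hm := h.measurable_sample N
  have := Measure.isProbabilityMeasure_map (μ := μ) hm.aemeasurable
  rw [← integral_map (f := chiSq Ξ) hm.aemeasurable
      (measurable_of_finite _).aestronglyMeasurable,
    integral_fintype Integrable.of_finite]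
  let e : (Fin N → Fin 2) × (Fin N → Fin J → Fin 2) ≃ Data J N :=
    { toFun := fun q i => (q.1 i, q.2 i)
      invFun := fun D => (fun i => (D i).1, fun i => (D i).2)
      left_inv := fun _ => rfl
      right_inv := fun _ => rfl }
  rw [← e.sum_comp, Fintype.sum_prod_type]
  have hterm : ∀ u y, (μ.map (sample x Y N)).real {e (u, y)} • chiSq Ξ (e (u, y)) =
      μ.real {ω | ∀ i : Fin N, x i ω = u i} *
        ((∏ i, marginalProb Ξ (u i) (y i)) * chiSq Ξ (fun i => (u i, y i))) := fun u y => by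
    rw [map_measureReal_apply hm (measurableSet_singleton _), smul_eq_mul, ← mul_assoc]
    congr 1
    exact h.measureReal_sample N u y
  simp only [hterm, ← Finset.mul_sum]
  have hx : ∑ u : Fin N → Fin 2, μ.real {ω | ∀ i : Fin N, x i ω = u i} = 1 := by
    have hX : Measurable (fun ω (i : Fin N) => x i ω) :=
      measurable_pi_lambda _ fun i => h.measurable_x i
    have := Measure.isProbabilityMeasure_map (μ := μ) hX.aemeasurable
    have h1 := sum_measureReal_singleton (μ := μ.map fun ω (i : Fin N) => x i ω) Finset.univ
    rw [Finset.coe_univ, probReal_univ] at h1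
    rw [← h1]
    refine Finset.sum_congr rfl fun u _ => ?_
    rw [map_measureReal_apply hX (measurableSet_singleton _)]
    congr 1
    ext ω
    simp [funext_iff]
  calc _ ≤ ∑ u : Fin N → Fin 2, μ.real {ω | ∀ i : Fin N, x i ω = u i} * (2 * 2 ^ J) :=
        Finset.sum_le_sum fun u _ =>
          mul_le_mul_of_nonneg_left (mean_chiSq_le Ξ u) measureReal_nonneg
    _ = 2 * 2 ^ J := by rw [← Finset.sum_mul, hx, one_mul]

/-- The chi-square statistic is bounded in probability. -/
lemma IsModel.measure_lt_chiSq_le [IsProbabilityMeasure μ] (h : IsModel μ Ξ x θ Y) (N : ℕ) {M : ℝ} (hM : 0 < M) :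
    μ {ω | M < chiSq Ξ (sample x Y N ω)} ≤ ENNReal.ofReal (2 * 2 ^ J / M) := by
  have hint : Integrable (fun ω => chiSq Ξ (sample x Y N ω)) μ :=
    (Integrable.of_finite (f := chiSq Ξ)
      (μ := μ.map (sample x Y N))).comp_measurable (h.measurable_sample N)
  have h1 := mul_meas_ge_le_integral_of_nonneg
    (Eventually.of_forall fun ω => chiSq_nonneg Ξ (sample x Y N ω)) hint M
  have h2 : μ.real {ω | M ≤ chiSq Ξ (sample x Y N ω)} ≤ 2 * 2 ^ J / M := by
    rw [le_div_iff₀ hM, mul_comm]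
    exact h1.trans (h.integral_chiSq_le N)
  calc μ {ω | M < chiSq Ξ (sample x Y N ω)} ≤ μ {ω | M ≤ chiSq Ξ (sample x Y N ω)} :=
        measure_mono fun ω (hω : M < _) => hω.le
    _ = ENNReal.ofReal (μ.real {ω | M ≤ chiSq Ξ (sample x Y N ω)}) := by simp
    _ ≤ _ := ENNReal.ofReal_le_ofReal h2

end Mean

/-! ### Stability of the least absolute deviations step -/

section LAD

variable {J : ℕ}

lemma convexOn_sum_abs (γ a : Fin J → ℝ) :
    ConvexOn ℝ Set.univ (fun c : ℝ => ∑ j, |γ j - a j * c|) := by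
  refine ⟨convex_univ, fun c _ c' _ s t hs ht hst => ?_⟩
  simp only [smul_eq_mul, Finset.mul_sum]
  rw [← Finset.sum_add_distrib]
  refine Finset.sum_le_sum fun j _ => ?_
  have e : γ j - a j * (s * c + t * c') = s * (γ j - a j * c) + t * (γ j - a j * c') := by
    linear_combination (-γ j) * hst
  rw [e]
  refine (abs_add_le _ _).trans_eq ?_
  rw [abs_mul, abs_mul, abs_of_nonneg hs, abs_of_nonneg ht]

/-- A minimizer of a convex function lies near a point where the function is smaller than at
nearby points on both sides. -/
lemma abs_sub_lt_of_convexOn {f : ℝ → ℝ} (hf : ConvexOn ℝ Set.univ f) {m r c : ℝ} (hr : 0 < r)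
    (hl : f m < f (m - r)) (hu : f m < f (m + r)) (hc : ∀ c', f c ≤ f c') : |c - m| < r := by
  rw [abs_lt]
  constructor
  · by_contra! h
    have hmem : m - r ∈ segment ℝ c m := by
      rw [segment_eq_Icc (by linarith)]
      constructor <;> linarith
    have := hf.le_on_segment (Set.mem_univ c) (Set.mem_univ m) hmem
    rw [max_eq_right (hc m)] at this
    linarith
  · by_contra! h
    have hmem : m + r ∈ segment ℝ m c := by
      rw [segment_eq_Icc (by linarith)]
      constructor <;> linarith
    have := hf.le_on_segment (Set.mem_univ m) (Set.mem_univ c) hmem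
    rw [max_eq_left (hc m)] at this
    linarith

lemma continuous_sum_abs (c : ℝ) :
    Continuous (fun Ξ : Param J => ∑ j, |Ξ.γ j - Ξ.a j * c|) :=
  continuous_finsetSum _ fun j _ =>
    ((continuous_γ j).sub ((continuous_a j).mul continuous_const)).abs

/-- Near a parameter equivalent to one that satisfies the minimal `L₁` condition, the least
absolute deviations step approximately recovers the DIF effects. -/
lemma ML1Condition.eventually_abs_shift_sub_lt {Ξ : Param J} (hΞ : ML1Condition Ξ) (c₀ : ℝ)
    (j : Fin J) {η : ℝ} (hη : 0 < η) :
    ∀ᶠ Ξ' in 𝓝 (Ξ.shift c₀), ∀ c, IsLADMinimizer Ξ' c → |(Ξ'.shift c).γ j - Ξ.γ j| < η := by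
  set A : ℝ := |Ξ.a j| + 1 with hA
  have hA0 : 0 < A := by positivity
  set r : ℝ := η / (2 * A) with hrdef
  have hr : 0 < r := by positivity
  -- The objective at the shifted parameter is that of `Ξ` translated by `-c₀`, so its strict
  -- minimum is at `-c₀`.
  have hval : ∀ s : ℝ, ∑ j, |(Ξ.shift c₀).γ j - (Ξ.shift c₀).a j * (-c₀ + s)| =
      ∑ j, |Ξ.γ j - Ξ.a j * s| := fun s =>
    Finset.sum_congr rfl fun j _ => by
      simp only [Param.shift]
      congr 1
      ring
  -- Used only at `s = ± r`: continuity in the parameter at fixed `c` suffices, since convexity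
  -- controls all other `c`.
  have hside : ∀ s : ℝ, s ≠ 0 → ∀ᶠ Ξ' in 𝓝 (Ξ.shift c₀),
      ∑ j, |Ξ'.γ j - Ξ'.a j * (-c₀)| < ∑ j, |Ξ'.γ j - Ξ'.a j * (-c₀ + s)| := fun s hs => by
    refine (continuous_sum_abs (-c₀)).continuousAt.eventually_lt
      (continuous_sum_abs (-c₀ + s)).continuousAt ?_
    rw [hval]
    have := hval 0
    simp only [add_zero, mul_zero, sub_zero] at this
    rw [this]
    exact hΞ s hs
  have ha : ∀ᶠ Ξ' in 𝓝 (Ξ.shift c₀), |Ξ'.a j| < A :=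
    (continuous_a j).abs.continuousAt.eventually_lt continuousAt_const
      (by simp [Param.shift, hA])
  have hγ : ∀ᶠ Ξ' in 𝓝 (Ξ.shift c₀), |Ξ'.γ j + Ξ'.a j * c₀ - Ξ.γ j| < η / 2 := by
    refine (((continuous_γ j).add ((continuous_a j).mul continuous_const)).sub
      continuous_const).abs.continuousAt.eventually_lt continuousAt_const ?_
    simpa [Param.shift] using hη
  filter_upwards [hside (-r) (by linarith), hside r hr.ne', ha, hγ] with Ξ' h1 h2 h3 h4 c hc
  have hcr : |c - -c₀| < r :=
    abs_sub_lt_of_convexOn (convexOn_sum_abs Ξ'.γ Ξ'.a) hr (by simpa [sub_eq_add_neg] using h1)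
      h2 hc
  have e : (Ξ'.shift c).γ j - Ξ.γ j =
      (Ξ'.γ j + Ξ'.a j * c₀ - Ξ.γ j) - Ξ'.a j * (c - -c₀) := by
    simp only [Param.shift]
    ring
  have h5 : |Ξ'.a j * (c - -c₀)| ≤ A * r := by
    rw [abs_mul]
    exact mul_le_mul h3.le hcr.le (abs_nonneg _) hA0.le
  have h6 : A * r = η / 2 := by
    rw [hrdef]
    field_simp
  rw [e]
  calc _ ≤ |Ξ'.γ j + Ξ'.a j * c₀ - Ξ.γ j| + |Ξ'.a j * (c - -c₀)| := abs_sub _ _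
    _ < η := by linarith

lemma Param.continuous_reflect : Continuous (Param.reflect : Param J → Param J) := by
  refine continuous_induced_rng.2 ?_
  exact continuous_β.neg.prodMk ((continuous_pi fun j => (continuous_a j).neg).prodMk
    ((continuous_pi fun j => continuous_d j).prodMk (continuous_pi fun j => continuous_γ j)))

@[simp]
lemma Param.reflect_reflect (Ξ : Param J) : Ξ.reflect.reflect = Ξ := by
  ext <;> simp [Param.reflect]

lemma Param.reflect_shift_γ (Ξ : Param J) (c : ℝ) (j : Fin J) :
    (Ξ.reflect.shift (-c)).γ j = (Ξ.shift c).γ j := by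
  simp [Param.reflect, Param.shift]

lemma IsLADMinimizer.reflect {Ξ : Param J} {c : ℝ} (h : IsLADMinimizer Ξ c) :
    IsLADMinimizer Ξ.reflect (-c) := fun c' => by
  simpa [Param.reflect] using h (-c')

/-- The unreflected statement is pulled back along the continuous involution `Param.reflect`, which
sends a minimizer `c` to `-c` and keeps the shifted effects. -/
lemma ML1Condition.eventually_abs_shift_sub_lt_reflect {Ξ : Param J} (hΞ : ML1Condition Ξ)
    (c₀ : ℝ) (j : Fin J) {η : ℝ} (hη : 0 < η) :
    ∀ᶠ Ξ' in 𝓝 (Ξ.shift c₀).reflect, ∀ c, IsLADMinimizer Ξ' c →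
      |(Ξ'.shift c).γ j - Ξ.γ j| < η := by
  have h := Param.continuous_reflect.tendsto (Ξ.shift c₀).reflect
  rw [Param.reflect_reflect] at h
  filter_upwards [h.eventually (hΞ.eventually_abs_shift_sub_lt c₀ j hη)] with Ξ' hΞ' c hc
  rw [← Param.reflect_shift_γ]
  exact hΞ' (-c) hc.reflect

end LAD

/-! ### Identification on compact sets -/

section Identification

variable {J : ℕ}

/-- The squared distance of the marginal probabilities of two parameters. -/
def marginalDist (Ξ Ξ' : Param J) : ℝ :=
  ∑ g, ∑ y, (marginalProb Ξ g y - marginalProb Ξ' g y) ^ 2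

lemma continuous_marginalDist (Ξ' : Param J) : Continuous (fun Ξ => marginalDist Ξ Ξ') :=
  continuous_finsetSum _ fun g _ => continuous_finsetSum _ fun y _ =>
    ((continuous_marginalProb g y).sub continuous_const).pow 2

lemma marginalDist_pos {Ξ Ξ' : Param J}
    (h : ¬ ∀ (g : Fin 2) (y : Fin J → Fin 2), marginalProb Ξ g y = marginalProb Ξ' g y) :
    0 < marginalDist Ξ Ξ' := by
  push Not at h
  obtain ⟨g, y, hgy⟩ := h
  refine Finset.sum_pos' (fun g _ => Finset.sum_nonneg fun y _ => sq_nonneg _)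
    ⟨g, Finset.mem_univ g, Finset.sum_pos' (fun y _ => sq_nonneg _) ⟨y, Finset.mem_univ y, ?_⟩⟩
  have := sub_ne_zero.2 hgy
  positivity

/-- The constrained part of `K` outside `U` is compact, and there the continuous distance is
positive, hence bounded away from zero. -/
lemma exists_pos_forall_mem_of_marginalDist_lt [NeZero J] {K U : Set (Param J)} (hK : IsCompact K)
    (hU : IsOpen U) (Ξ' : Param J)
    (hident : ∀ Ξ ∈ K, Ξ.γ 0 = 0 →
      (∀ (g : Fin 2) (y : Fin J → Fin 2), marginalProb Ξ g y = marginalProb Ξ' g y) → Ξ ∈ U) :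
    ∃ ε > 0, ∀ Ξ ∈ K, Ξ.γ 0 = 0 → marginalDist Ξ Ξ' < ε → Ξ ∈ U := by
  have hclosed : IsClosed {Ξ : Param J | Ξ.γ 0 = 0} :=
    isClosed_eq (continuous_γ 0) continuous_const
  have hC : IsCompact ((K ∩ {Ξ | Ξ.γ 0 = 0}) \ U) := (hK.inter_right hclosed).diff hU
  obtain ⟨ε, hε, h⟩ := hC.exists_forall_le' (continuous_marginalDist Ξ').continuousOn
    (a := 0) fun Ξ hΞ => marginalDist_pos fun heq => hΞ.2 (hident Ξ hΞ.1.1 hΞ.1.2 heq)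
  refine ⟨ε, hε, fun Ξ hΞK hΞ0 hlt => ?_⟩
  by_contra hΞU
  exact (h Ξ ⟨⟨hΞK, hΞ0⟩, hΞU⟩).not_gt hlt

lemma marginalDist_le {N : ℕ} (D : Data J N) (Ξ Ξ' : Param J)
    (h : Real.log (likelihood D Ξ') ≤ Real.log (likelihood D Ξ)) {M m : ℝ} (hm : 0 < m)
    (hD : ∀ g, m ≤ groupCount D g) (hM : chiSq Ξ' D ≤ M) :
    marginalDist Ξ Ξ' ≤ 2 * 2 ^ J * (9 * M / m) := by
  calc marginalDist Ξ Ξ' ≤ ∑ _g : Fin 2, ∑ _y : Fin J → Fin 2, 9 * M / m :=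
        Finset.sum_le_sum fun g _ => Finset.sum_le_sum fun y _ => by
          rw [le_div_iff₀ hm, mul_comm]
          exact (mul_le_mul_of_nonneg_right (hD g) (sq_nonneg _)).trans
            ((groupCount_mul_sq_sub_le D Ξ Ξ' h g y).trans (by linarith))
    _ = _ := by simp; ring

end Identification

/-! ### Consistency -/

section Consistency

variable {Ω : Type*} [MeasurableSpace Ω] {μ : Measure Ω} {J : ℕ}
  {Ξ : Param J} {x : ℕ → Ω → Fin 2} {θ : ℕ → Ω → ℝ} {Y : ℕ → Ω → Fin J → Fin 2}

lemma groupCount_sample {Ω : Type*} (x : ℕ → Ω → Fin 2) (Y : ℕ → Ω → Fin J → Fin 2) (N : ℕ)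
    (ω : Ω) (g : Fin 2) :
    groupCount (sample x Y N ω) g = ((Finset.range N).filter (fun i => x i ω = g)).card := by
  rw [groupCount, Finset.card_filter, Finset.card_filter, Finset.sum_range]
  rfl

/-- An event about the data has probability tending to one iff its complement has probability
tending to zero. -/
lemma IsModel.tendsto_measure_one_iff [IsProbabilityMeasure μ] (h : IsModel μ Ξ x θ Y)
    (P : (N : ℕ) → Data J N → Prop) :
    Tendsto (fun N => μ {ω | P N (sample x Y N ω)}) atTop (𝓝 1) ↔
      Tendsto (fun N => μ {ω | ¬ P N (sample x Y N ω)}) atTop (𝓝 0) := by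
  have hP : ∀ N, μ {ω | P N (sample x Y N ω)} = 1 - μ {ω | ¬ P N (sample x Y N ω)} := fun N => by
    rw [← prob_compl_eq_one_sub (h.measurableSet_sample N fun D => ¬ P N D)]
    congr 1
    ext ω
    simp
  have hnP : ∀ N, μ {ω | ¬ P N (sample x Y N ω)} = 1 - μ {ω | P N (sample x Y N ω)} := fun N => by
    rw [← prob_compl_eq_one_sub (h.measurableSet_sample N (P N))]
    rfl
  constructor
  · intro ht
    simp only [hnP]
    simpa using ENNReal.Tendsto.sub (tendsto_const_nhds (x := (1 : ENNReal))) ht (by simp)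
  · intro ht
    simp only [hP]
    simpa using ENNReal.Tendsto.sub (tendsto_const_nhds (x := (1 : ENNReal))) ht (by simp)

/-- The marginal maximum likelihood estimate is eventually in any neighbourhood of the two
parameters that are compatible with the true response probabilities. -/
lemma IsModel.tendsto_measure_estimate_mem [IsProbabilityMeasure μ] [NeZero J]
    (h : IsModel μ Ξ x θ Y)
    (hgroups : ∀ (g : Fin 2) (M : ℕ),
      Tendsto (fun N : ℕ => μ {ω | M ≤ ((Finset.range N).filter (fun i => x i ω = g)).card})
        atTop (𝓝 1))
    {Θ : Set (Param J)} {Ξdag : Param J} (hdag : ∃ c, Ξdag = Ξ.shift c)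
    (hdag_zero : Ξdag.γ 0 = 0) (hdag_mem : Ξdag ∈ Θ)
    (hident : ∀ Ξ ∈ Θ, Ξ.γ 0 = 0 →
      (∀ (g : Fin 2) (y : Fin J → Fin 2), marginalProb Ξ g y = marginalProb Ξdag g y) →
      Ξ = Ξdag ∨ Ξ = Ξdag.reflect)
    {Ξtilde : (N : ℕ) → Data J N → Param J}
    (hmle : Tendsto (fun N : ℕ => μ {ω | IsMMLEstimate Θ (sample x Y N ω)
      (Ξtilde N (sample x Y N ω))}) atTop (𝓝 1))
    {K : Set (Param J)} (hK : IsCompact K) (hKΘ : K ⊆ Θ)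
    (htight : Tendsto (fun N : ℕ => μ {ω | Ξtilde N (sample x Y N ω) ∈ K}) atTop (𝓝 1))
    {U : Set (Param J)} (hU : IsOpen U) (hdagU : Ξdag ∈ U) (hreflU : Ξdag.reflect ∈ U) :
    Tendsto (fun N : ℕ => μ {ω | Ξtilde N (sample x Y N ω) ∈ U}) atTop (𝓝 1) := by
  -- The likelihood comparison is with `Ξdag`, whereas the moment bound is for the true parameter;
  -- shift invariance identifies the two statistics.
  have hchi : ∀ (N : ℕ) (D : Data J N), chiSq Ξdag D = chiSq Ξ D := fun N D => by
    obtain ⟨c, rfl⟩ := hdag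
    simp only [chiSq, marginalProb_shift]
  obtain ⟨ε, hε, hεU⟩ := exists_pos_forall_mem_of_marginalDist_lt hK hU Ξdag
    fun Ξ' hΞ' h0 heq => by
      rcases hident Ξ' (hKΘ hΞ') h0 heq with rfl | rfl
      exacts [hdagU, hreflU]
  simp only [← groupCount_sample x Y] at hgroups
  refine (h.tendsto_measure_one_iff fun N D => Ξtilde N D ∈ U).2 ?_
  have hmle' := (h.tendsto_measure_one_iff fun N D => IsMMLEstimate Θ D (Ξtilde N D)).1 hmle
  have htight' := (h.tendsto_measure_one_iff fun N D => Ξtilde N D ∈ K).1 htight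
  have hgroups' := fun g M =>
    (h.tendsto_measure_one_iff fun N D => M ≤ groupCount D g).1 (hgroups g M)
  rw [ENNReal.tendsto_atTop_zero]
  intro η hη
  -- Order of choice: `M` makes a large chi-square improbable, then the group size `m` makes the
  -- bound of `marginalDist_le` smaller than `ε`.
  obtain ⟨M, hM, hMη⟩ : ∃ M : ℝ, 0 < M ∧ ENNReal.ofReal (2 * 2 ^ J / M) ≤ η / 2 := by
    have ht : Tendsto (fun M : ℝ => ENNReal.ofReal (2 * 2 ^ J / M)) atTop (𝓝 0) := by
      simpa using ENNReal.tendsto_ofReal (tendsto_id.const_div_atTop (2 * 2 ^ J : ℝ))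
    have := ht.eventually_le_const (ENNReal.half_pos hη.ne')
    exact ((eventually_gt_atTop 0).and this).exists
  obtain ⟨m, hm, hmε⟩ : ∃ m : ℕ, 0 < m ∧ 2 * 2 ^ J * (9 * M / m) < ε := by
    have ht : Tendsto (fun m : ℕ => 2 * 2 ^ J * (9 * M / (m : ℝ))) atTop (𝓝 0) := by
      simpa using (tendsto_const_div_atTop_nhds_zero_nat (9 * M)).const_mul (2 * 2 ^ J : ℝ)
    exact ((eventually_gt_atTop 0).and (ht.eventually_lt_const hε)).exists
  have hsum := ((hmle'.add htight').add (hgroups' 0 m)).add (hgroups' 1 m)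
  simp only [add_zero] at hsum
  obtain ⟨N₀, hN₀⟩ := eventually_atTop.1 (hsum.eventually_le_const (ENNReal.half_pos hη.ne'))
  refine ⟨N₀, fun N hN => ?_⟩
  have hsub : {ω | ¬ Ξtilde N (sample x Y N ω) ∈ U} ⊆
      ((({ω | ¬ IsMMLEstimate Θ (sample x Y N ω) (Ξtilde N (sample x Y N ω))} ∪
        {ω | ¬ Ξtilde N (sample x Y N ω) ∈ K}) ∪
        {ω | ¬ m ≤ groupCount (sample x Y N ω) 0}) ∪
        {ω | ¬ m ≤ groupCount (sample x Y N ω) 1}) ∪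
        {ω | M < chiSq Ξ (sample x Y N ω)} := by
    intro ω hω
    by_contra hcon
    simp only [Set.mem_union, Set.mem_ofPred_eq, not_or, not_not, not_lt] at hcon hω
    obtain ⟨⟨⟨⟨h1, h2⟩, h3⟩, h4⟩, h5⟩ := hcon
    refine hω (hεU _ h2 h1.1.2 (lt_of_le_of_lt ?_ hmε))
    refine marginalDist_le (sample x Y N ω) _ _ (h1.2 Ξdag hdag_mem hdag_zero)
      (Nat.cast_pos.2 hm) (fun g => ?_) ((hchi N _).trans_le h5)
    fin_cases g
    exacts [Nat.cast_le.2 h3, Nat.cast_le.2 h4]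
  calc _ ≤ _ := measure_mono hsub
    _ ≤ _ := measure_union_le _ _
    _ ≤ η / 2 + η / 2 := add_le_add
        ((measure_union_le _ _).trans (le_trans (add_le_add_left ((measure_union_le _ _).trans
          (add_le_add_left (measure_union_le _ _) _)) _) (hN₀ N hN)))
        ((h.measure_lt_chiSq_le N hM).trans hMη)
    _ = η := ENNReal.add_halves η

end Consistency

end MIMIC

end

theorem theorem2 {Ω : Type*} [MeasurableSpace Ω] (μ : Measure Ω) [IsProbabilityMeasure μ]
    {J : ℕ} [NeZero J]
    -- the true model, and individuals sampled from it
    (Ξstar : MIMIC.Param J)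
    (x : ℕ → Ω → Fin 2) (θ : ℕ → Ω → ℝ) (Y : ℕ → Ω → Fin J → Fin 2)
    (hmodel : MIMIC.IsModel μ Ξstar x θ Y)
    -- the sizes of both groups tend to infinity (in probability)
    (hgroups : ∀ (g : Fin 2) (M : ℕ),
      Tendsto (fun N : ℕ => μ {ω | M ≤ ((Finset.range N).filter (fun i => x i ω = g)).card})
        atTop (𝓝 1))
    (hML1 : MIMIC.ML1Condition Ξstar)
    -- the equivalent model with zero DIF effect of item 1, in the parameter space `Θ`
    (Θ : Set (MIMIC.Param J)) (Ξdag : MIMIC.Param J)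
    (hdag : ∃ c : ℝ, Ξdag = Ξstar.shift c) (hdag_zero : Ξdag.γ 0 = 0) (hdag_mem : Ξdag ∈ Θ)
    -- it is identified in `Θ`, up to the sign of the latent trait
    (hident : ∀ Ξ ∈ Θ, Ξ.γ 0 = 0 →
      (∀ (g : Fin 2) (y : Fin J → Fin 2),
        MIMIC.marginalProb Ξ g y = MIMIC.marginalProb Ξdag g y) →
      Ξ = Ξdag ∨ Ξ = Ξdag.reflect)
    -- the two steps of the algorithm, which have solutions with probability tending to 1
    (Ξtilde : (N : ℕ) → MIMIC.Data J N → MIMIC.Param J)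
    (chat : (N : ℕ) → MIMIC.Data J N → ℝ)
    (hstep1 : Tendsto (fun N : ℕ => μ {ω | MIMIC.IsMMLEstimate Θ (MIMIC.sample x Y N ω)
      (Ξtilde N (MIMIC.sample x Y N ω))}) atTop (𝓝 1))
    (hstep2 : Tendsto (fun N : ℕ => μ {ω | MIMIC.IsLADMinimizer
      (Ξtilde N (MIMIC.sample x Y N ω)) (chat N (MIMIC.sample x Y N ω))}) atTop (𝓝 1))
    -- the estimates of step 1 stay in a compact part of `Θ` with probability tending to 1
    (K : Set (MIMIC.Param J)) (hK : IsCompact K) (hKΘ : K ⊆ Θ)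
    (htight : Tendsto (fun N : ℕ => μ {ω | Ξtilde N (MIMIC.sample x Y N ω) ∈ K}) atTop (𝓝 1))
    -- the threshold
    (δ : ℝ) (hδ : 0 < δ) (hδ_lt : ∀ j, Ξstar.γ j ≠ 0 → δ < |Ξstar.γ j|) :
    ∀ j : Fin J, Tendsto (fun N : ℕ => μ {ω |
      |((Ξtilde N (MIMIC.sample x Y N ω)).shift (chat N (MIMIC.sample x Y N ω))).γ j| ≤ δ ↔
        Ξstar.γ j = 0}) atTop (𝓝 1) := by
  intro j
  obtain ⟨c₀, hc₀⟩ := hdag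
  -- The tolerance is the distance from the true effect to the threshold: `δ` for a zero effect,
  -- `|γ| - δ` otherwise.
  obtain ⟨η, hη, hηδ⟩ : ∃ η > 0, ∀ t : ℝ, |t - Ξstar.γ j| < η → (|t| ≤ δ ↔ Ξstar.γ j = 0) := by
    by_cases h0 : Ξstar.γ j = 0
    · exact ⟨δ, hδ, fun t ht => iff_of_true (by simpa [h0] using ht.le) h0⟩
    · refine ⟨|Ξstar.γ j| - δ, sub_pos.2 (hδ_lt j h0), fun t ht => iff_of_false ?_ h0⟩
      have := abs_sub_abs_le_abs_sub (Ξstar.γ j) t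
      rw [abs_sub_comm] at this
      exact not_le.2 (by linarith)
  obtain ⟨U₁, hU₁, hU₁o, hmem₁⟩ := eventually_nhds_iff.1
    (hML1.eventually_abs_shift_sub_lt c₀ j hη)
  obtain ⟨U₂, hU₂, hU₂o, hmem₂⟩ := eventually_nhds_iff.1
    (hML1.eventually_abs_shift_sub_lt_reflect c₀ j hη)
  rw [← hc₀] at hmem₁ hmem₂
  have hU := hmodel.tendsto_measure_estimate_mem hgroups ⟨c₀, hc₀⟩ hdag_zero hdag_mem hident
    hstep1 hK hKΘ htight (hU₁o.union hU₂o) (Or.inl hmem₁) (Or.inr hmem₂)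
  have hU' := (hmodel.tendsto_measure_one_iff fun N D => Ξtilde N D ∈ U₁ ∪ U₂).1 hU
  have hstep2' := (hmodel.tendsto_measure_one_iff fun N D =>
    MIMIC.IsLADMinimizer (Ξtilde N D) (chat N D)).1 hstep2
  refine (hmodel.tendsto_measure_one_iff fun N D =>
    |((Ξtilde N D).shift (chat N D)).γ j| ≤ δ ↔ Ξstar.γ j = 0).2 ?_
  have hsum := hU'.add hstep2'
  rw [add_zero] at hsum
  refine tendsto_of_tendsto_of_tendsto_of_le_of_le tendsto_const_nhds hsum
    (fun _ => zero_le) fun N => (measure_mono fun ω hω => ?_).trans (measure_union_le _ _)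
  by_contra hcon
  have hmem : Ξtilde N (MIMIC.sample x Y N ω) ∈ U₁ ∪ U₂ := not_not.1 fun h => hcon (Or.inl h)
  have hlad := not_not.1 fun h => hcon (Or.inr h)
  refine hω (hηδ _ ?_)
  rcases hmem with h | h
  exacts [hU₁ _ h _ hlad, hU₂ _ h _ hlad]
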